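/- Let $\mathbb D$ be the open unit disc in $\mathbb C$, $\mathbb T=\partial\mathbb D$, and for $z,w\in\mathbb C^n$ put $z\bullet w=\sum_{j=1}^n z_jw_j$. Let $D=\Omega+i\mathbb R^n\subset\mathbb C^n$, with $\Omega\subset\mathbb R^n$ a non-empty open convex set, be a convex tube domain which is taut, i.e. every sequence of holomorphic maps $\mathbb D\to D$ has a subsequence which either converges locally uniformly on $\mathbb D$ to a holomorphic map $\mathbb D\to D$ or is compactly divergent. Let $\varphi:\mathbb D\to D$ be a complex geodesic, i.e. a holomorphic map that is an isometry with respect to the Poincaré distance of $\mathbb D$ and the Carathéodory pseudodistance of $D$, and let $f:D\to\mathbb D$ be a left inverse of $\varphi$, i.e. a holomorphic function with $f\circ\varphi=\mathrm{id}_{\mathbb D}$. Define $$h(\lambda):=\left(\frac{\partial f}{\partial z_1}(\varphi(\lambda)),\ldots,\frac{\partial f}{\partial z_n}(\varphi(\lambda))\right),\qquad \lambda\in\mathbb D.$$ Then: (i) there are $a\in\mathbb C^n$ and $b\in\mathbb R^n$ such that $h(\lambda)=\bar a\lambda^2+b\lambda+a$ for all $\lambda\in\mathbb D$, and $h\not\equiv0$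 on $\mathbb D$; by this formula $h$ is extended to $\mathbb C$; (ii) for almost every $\lambda\in\mathbb T$ (with respect to Lebesgue measure on $\mathbb T$) the radial limit $\varphi^*(\lambda)=\lim_{r\to1^-}\varphi(r\lambda)$ exists in $\mathbb C^n$ and $$\operatorname{Re}\left[\bar\lambda\,h(\lambda)\bullet(z-\varphi^*(\lambda))\right]<0\quad\text{for all } z\in D;$$ (iii) for every $\lambda\in\mathbb D\setminus\{0\}$, $$\operatorname{Re}\left[h(\lambda)\bullet\frac{\varphi(0)-\varphi(\lambda)}{\lambda}\right]<0.$$ -/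

import Mathlib

open Set Filter Topology MeasureTheory

noncomputable section

namespace TubeGeodesic

/-- The open unit disc `𝔻` in `ℂ`. -/
def disc : Set ℂ := Metric.ball 0 1

/-- `φ ∈ 𝒪(𝔻, D)`: the map `φ` is holomorphic on the unit disc and maps it into `D`.
Only the values of `φ` on the disc matter. -/
def IsHoloDisc {n : ℕ} (D : Set (Fin n → ℂ)) (φ : ℂ → Fin n → ℂ) : Prop :=
  DifferentiableOn ℂ φ disc ∧ MapsTo φ disc D

/-- `f ∈ 𝒪(D, 𝔻)`: the function `f` is holomorphic on `D` with values in the unit disc.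
Only the values of `f` on `D` matter. -/
def IsHoloToDisc {n : ℕ} (D : Set (Fin n → ℂ)) (f : (Fin n → ℂ) → ℂ) : Prop :=
  DifferentiableOn ℂ f D ∧ MapsTo f D disc

/-- `D = Ω + iℝⁿ` for a convex domain (non-empty, open, convex set) `Ω ⊆ ℝⁿ`. -/
def IsConvexTube {n : ℕ} (D : Set (Fin n → ℂ)) : Prop :=
  ∃ Ω : Set (Fin n → ℝ), IsOpen Ω ∧ Ω.Nonempty ∧ Convex ℝ Ω ∧
    D = {z | (fun j => (z j).re) ∈ Ω}

/-- `D` is taut: `𝒪(𝔻, D)` is a normal family, i.e. every sequence in `𝒪(𝔻, D)` has a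
subsequence which either converges locally uniformly on `𝔻` to an element of `𝒪(𝔻, D)`,
or is compactly divergent. -/
def IsTaut {n : ℕ} (D : Set (Fin n → ℂ)) : Prop :=
  ∀ F : ℕ → ℂ → Fin n → ℂ, (∀ k, IsHoloDisc D (F k)) →
    ∃ σ : ℕ → ℕ, StrictMono σ ∧
      ((∃ g : ℂ → Fin n → ℂ, IsHoloDisc D g ∧
          TendstoLocallyUniformlyOn (fun k => F (σ k)) g atTop disc) ∨
        (∀ (K : Set ℂ) (L : Set (Fin n → ℂ)), IsCompact K → K ⊆ disc → IsCompact L → L ⊆ D →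
          ∀ᶠ k in atTop, Disjoint (F (σ k) '' K) L))

/-- The Poincaré distance `artanh |(z - w) / (1 - w̄ z)|` of two points of the unit disc. -/
def poincareDist (z w : ℂ) : ℝ :=
  Real.artanh ‖(z - w) / (1 - star w * z)‖

/-- The Carathéodory pseudodistance of `D`: the supremum of the Poincaré distances of `f z` and
`f w` over all `f ∈ 𝒪(D, 𝔻)`. It is taken in `[0, ∞]`, so that no boundedness is presupposed. -/
def caratheodoryDist {n : ℕ} (D : Set (Fin n → ℂ)) (z w : Fin n → ℂ) : ENNReal :=
  ⨆ (f : (Fin n → ℂ) → ℂ) (_ : IsHoloToDisc D f), ENNReal.ofReal (poincareDist (f z) (f w))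

/-- `φ : 𝔻 → D` is a complex geodesic: it is holomorphic and an isometry for the Poincaré distance
of `𝔻` and the Carathéodory pseudodistance of `D`. -/
def IsComplexGeodesic {n : ℕ} (D : Set (Fin n → ℂ)) (φ : ℂ → Fin n → ℂ) : Prop :=
  IsHoloDisc D φ ∧
    ∀ z ∈ disc, ∀ w ∈ disc,
      caratheodoryDist D (φ z) (φ w) = ENNReal.ofReal (poincareDist z w)

/-- `f ∈ 𝒪(D, 𝔻)` with `f ∘ φ = id` on `𝔻`. -/
def IsLeftInverse {n : ℕ} (D : Set (Fin n → ℂ)) (φ : ℂ → Fin n → ℂ)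
    (f : (Fin n → ℂ) → ℂ) : Prop :=
  IsHoloToDisc D f ∧ ∀ z ∈ disc, f (φ z) = z

/-- The tuple `(∂f/∂z₁, …, ∂f/∂zₙ)` of complex partial derivatives at the point `z`. -/
def complexGradient {n : ℕ} (f : (Fin n → ℂ) → ℂ) (z : Fin n → ℂ) : Fin n → ℂ :=
  fun j => fderiv ℂ f z (Pi.single j 1)

/-- The map `ζ ↦ ā ζ² + b ζ + a`. -/
def quadMap {n : ℕ} (a : Fin n → ℂ) (b : Fin n → ℝ) (ζ : ℂ) : Fin n → ℂ :=
  fun j => star (a j) * ζ ^ 2 + (b j : ℂ) * ζ + a j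

/-- `w` is the radial limit `lim_{r → 1⁻} φ(r ζ)`. -/
def IsRadialLimit {n : ℕ} (φ : ℂ → Fin n → ℂ) (ζ : ℂ) (w : Fin n → ℂ) : Prop :=
  Tendsto (fun r : ℝ => φ ((r : ℂ) * ζ)) (𝓝[<] 1) (𝓝 w)

/-- `P` holds for almost every point of the unit circle with respect to arc length. -/
def AEOnCircle (P : ℂ → Prop) : Prop :=
  ∀ᵐ θ : ℝ ∂(volume.restrict (Ioc 0 (2 * Real.pi))), P (Complex.exp (θ * Complex.I))

end TubeGeodesic

end

/-! Everything rests on one variational inequality. For a holomorphic disc `ψ` in `D`, convexity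
puts `φ + t(ψ - φ)` in `D` for `t ∈ [0, 1]`, so `f ∘ (φ + t(ψ - φ))` is a self-map of the disc,
equal to the identity at `t = 0`. Schwarz–Pick between `0` and `l` is then an equality at `t = 0`,
and its one-sided derivative there gives `fderiv_left_inverse_generator`, an inequality linear in `ψ
- φ`.

Three choices of `ψ` give the theorem. Imaginary translates `φ ± i eⱼ`, allowed in a tube, turn the
inequality into an equality, which forces `h` to be quadratic (`exists_eq_quadratic`). Constants `ψ
= z` give the boundary inequality as `l` tends radially to the circle. The constant `ψ = φ 0` gives
(iii). Strictness comes from openness of `D` in the boundary case and from the open mapping theorem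
in the interior case; `f ∘ φ = id` yields `h 0 ⬝ᵥ φ'(0) = 1`, hence `h ≢ 0`.

Radial limits: tautness excludes real lines in `Ω`, so the functionals bounded above on `Ω` span the
dual. Composed with `φ`, each has values in a half-plane, and Fatou's theorem applies. -/

/-! ### Fatou's theorem for bounded functions and for half-plane valued functions. -/

/-- Cauchy's formula for the derivative, with boundary values that are only continuous. -/
theorem DiffContOnCl.circleAverage_inv_sq_mul {F : ℂ → ℂ}
    (hF : DiffContOnCl ℂ F (Metric.ball 0 1)) {z : ℂ} (hz : z ∈ Metric.ball (0 : ℂ) 1) :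
    Real.circleAverage (fun w ↦ (w / (w - z) ^ 2) * F w) 0 1 = deriv F z := by
  have hcl : closure (Metric.ball (0 : ℂ) 1) = Metric.closedBall 0 1 := closure_ball 0 one_ne_zero
  have hcs : ContinuousOn F (Metric.sphere 0 1) :=
    hF.2.mono (hcl ▸ Metric.sphere_subset_closedBall)
  have hint : CircleIntegrable F 0 1 := hcs.circleIntegrable zero_le_one
  have h1 := hasDerivAt_circleAverage_herglotzRieszKernel_smul hint hz
  -- The Herglotz kernel is `2ζ/(ζ - w) - 1`, so Cauchy's formula and the mean value property
  -- evaluate the integral; differentiating both sides in `w` gives the claim.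
  have h2 : (fun w ↦ Real.circleAverage (fun ζ ↦ herglotzRieszKernel 0 w ζ • F ζ) 0 1)
      =ᶠ[𝓝 z] fun w ↦ 2 * F w - F 0 := by
    filter_upwards [Metric.isOpen_ball.mem_nhds hz] with w hw
    have hw' : w ∈ Metric.ball (0 : ℂ) |1| := by simpa using hw
    have hF' : DiffContOnCl ℂ F (Metric.ball 0 |1|) := by simpa using hF
    have e1 := hF'.circleAverage_smul_div hw'
    have e2 := hF'.circleAverage
    have hne : ∀ ζ ∈ Metric.sphere (0 : ℂ) 1, ζ - w ≠ 0 := by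
      rintro ζ hζ h0
      rw [sub_eq_zero] at h0
      simp_all
    rw [← e1, ← e2, ← smul_eq_mul, ← Real.circleAverage_fun_smul, ← Real.circleAverage_fun_sub]
    · refine Real.circleAverage_congr_sphere fun ζ hζ ↦ ?_
      have := hne ζ (by simpa using hζ)
      simp only [herglotzRieszKernel, sub_zero, smul_eq_mul]
      field_simp
      ring
    · have hq : ContinuousOn (fun ζ ↦ ζ / (ζ - w)) (Metric.sphere 0 1) :=
        ContinuousOn.div (by fun_prop) (by fun_prop) hne
      have hm : ContinuousOn (fun ζ ↦ (2 : ℂ) • ((ζ / (ζ - w)) • F ζ)) (Metric.sphere 0 1) :=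
        continuousOn_const.mul (hq.mul hcs)
      simp only [sub_zero]
      exact hm.circleIntegrable zero_le_one
    · exact hint
  have h3 : HasDerivAt F (deriv F z) z :=
    (hF.differentiableAt Metric.isOpen_ball hz).hasDerivAt
  have h4 := (h1.congr_of_eventuallyEq h2.symm).unique ((h3.const_mul 2).sub_const (F 0))
  have h5 : Real.circleAverage (fun ζ ↦ (2 * ζ / (ζ - z) ^ 2) • F ζ) 0 1
      = 2 * Real.circleAverage (fun w ↦ (w / (w - z) ^ 2) * F w) 0 1 := by
    rw [← smul_eq_mul, ← Real.circleAverage_fun_smul]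
    congr 1
    ext ζ
    simp only [smul_eq_mul]
    ring
  rw [h5] at h4
  exact mul_left_cancel₀ two_ne_zero h4

theorem norm_circleAverage_le {F : ℂ → ℂ} {u : ℂ → ℝ} {c : ℂ} {R : ℝ}
    (hu : CircleIntegrable u c R) (h : ∀ w ∈ Metric.sphere c |R|, ‖F w‖ ≤ u w) :
    ‖Real.circleAverage F c R‖ ≤ Real.circleAverage u c R := by
  rw [Real.circleAverage, Real.circleAverage, norm_smul, smul_eq_mul,
    Real.norm_of_nonneg (by positivity)]
  gcongr
  refine intervalIntegral.norm_integral_le_of_norm_le (by positivity) ?_ hu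
  filter_upwards with θ _
  exact h _ (circleMap_mem_sphere' c R θ)

/-- The difference of the Cauchy kernels (for the derivative) of a point and of its reflection
is controlled by the Poisson kernel. -/
theorem norm_cauchyKernel_sub_reflection_mul_le {r : ℝ} (hr0 : 0 < r) (hr1 : r < 1) {w : ℂ}
    (hw : ‖w‖ = 1) :
    ‖w / (w - r) ^ 2 - w / (w - (r : ℂ)⁻¹) ^ 2‖ * ‖w - 1‖ ≤ 4 * poissonKernel 0 r w := by
  have hrn : ‖(r : ℂ)‖ = r := by simp [abs_of_pos hr0]
  have hr : (r : ℂ) ≠ 0 := by exact_mod_cast hr0.ne'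
  have hne : w - r ≠ 0 := by
    intro h; rw [sub_eq_zero] at h; rw [h, hrn] at hw; linarith
  have hconj : w * (starRingEnd ℂ) w = 1 := by
    rw [Complex.mul_conj, Complex.normSq_eq_norm_sq, hw]; simp
  have hrefl : ‖w - (r : ℂ)⁻¹‖ = ‖w - r‖ / r := by
    have : w - (r : ℂ)⁻¹ = -(w / r) * (starRingEnd ℂ) (w - r) := by
      rw [map_sub, Complex.conj_ofReal]
      field_simp
      linear_combination hconj
    rw [this, norm_mul, norm_neg, norm_div, hw, hrn, RCLike.norm_conj]
    ring
  set d := ‖w - r‖ with hd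
  have hd0 : 0 < d := norm_pos_iff.2 hne
  have hne' : w - (r : ℂ)⁻¹ ≠ 0 := by
    rw [← norm_pos_iff, hrefl]; positivity
  have hK : w / (w - r) ^ 2 - w / (w - (r : ℂ)⁻¹) ^ 2
      = w * ((r - (r : ℂ)⁻¹) * ((w - r) + (w - (r : ℂ)⁻¹))) /
        ((w - r) ^ 2 * (w - (r : ℂ)⁻¹) ^ 2) := by
    rw [div_sub_div _ _ (pow_ne_zero 2 hne) (pow_ne_zero 2 hne')]
    congr 1
    ring
  have hrr : ‖(r : ℂ) - (r : ℂ)⁻¹‖ = (1 - r ^ 2) / r := by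
    have : (r : ℂ) - (r : ℂ)⁻¹ = ((r - r⁻¹ : ℝ) : ℂ) := by push_cast; ring
    rw [this, Complex.norm_real, Real.norm_eq_abs, abs_of_nonpos]
    · field_simp; ring
    · have := (one_lt_inv₀ hr0).2 hr1; linarith
  have h1r : 1 - r ≤ d := by
    have := norm_sub_norm_le w r
    rw [hw, hrn] at this
    exact this
  have hw1 : ‖w - 1‖ ≤ 2 * d := by
    have h2 : ‖w - 1‖ ≤ ‖w - r‖ + ‖(r : ℂ) - 1‖ := by
      simpa using norm_add_le (w - r) ((r : ℂ) - 1)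
    have h3 : ‖(r : ℂ) - 1‖ = 1 - r := by
      have : (r : ℂ) - 1 = ((r - 1 : ℝ) : ℂ) := by push_cast; ring
      rw [this, Complex.norm_real, Real.norm_eq_abs, abs_of_neg (by linarith)]; ring
    linarith
  have hsum : ‖(w - r) + (w - (r : ℂ)⁻¹)‖ ≤ d + d / r := by
    refine (norm_add_le _ _).trans ?_
    rw [hrefl]
  have hnum : 0 ≤ (1 - r ^ 2) / r := by
    have : r ^ 2 ≤ 1 := by nlinarith
    exact div_nonneg (by linarith) hr0.le
  rw [hK, norm_div, norm_mul, norm_mul, norm_mul, norm_pow, norm_pow, hw, hrr, hrefl, one_mul,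
    poissonKernel_def, sub_zero, sub_zero, hw, hrn, ← hd]
  calc (1 - r ^ 2) / r * ‖(w - r) + (w - (r : ℂ)⁻¹)‖ / (d ^ 2 * (d / r) ^ 2) * ‖w - 1‖
      ≤ (1 - r ^ 2) / r * (d + d / r) / (d ^ 2 * (d / r) ^ 2) * (2 * d) := by gcongr
    _ = 2 * (1 + r) * ((1 ^ 2 - r ^ 2) / d ^ 2) := by field_simp; ring
    _ ≤ 4 * ((1 ^ 2 - r ^ 2) / d ^ 2) := by
      have : 0 ≤ (1 ^ 2 - r ^ 2) / d ^ 2 := div_nonneg (by nlinarith) (by positivity)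
      nlinarith

theorem circleAverage_poissonKernel {z : ℂ} (hz : z ∈ Metric.ball (0 : ℂ) 1) :
    Real.circleAverage (poissonKernel 0 z) 0 1 = 1 := by
  have h := (diffContOnCl_const (c := (1 : ℂ)) (𝕜 := ℂ)
    (s := Metric.ball (0 : ℂ) 1)).circleAverage_poissonKernel_smul hz
  have h2 : Real.circleAverage (poissonKernel 0 z • fun _ : ℂ ↦ (1 : ℂ)) 0 1
      = ((Real.circleAverage (poissonKernel 0 z) 0 1 : ℝ) : ℂ) := by
    simp only [Real.circleAverage, Complex.real_smul, Pi.smul_apply', mul_one]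
    rw [intervalIntegral.integral_ofReal]
    simp
  rw [h2] at h
  exact_mod_cast h

theorem continuousOn_poissonKernel {z : ℂ} (hz : z ∈ Metric.ball (0 : ℂ) 1) :
    ContinuousOn (poissonKernel 0 z) (Metric.sphere 0 1) := by
  rw [poissonKernel_eq_re_herglotzRieszKernel]
  have := continuousOn_herglotzRieszKernel_sphere hz
  rw [abs_one] at this
  exact Complex.continuous_re.comp_continuousOn this

/-- If `F` is Lipschitz and holomorphic in the unit disc, and is differentiable along the unit
circle at `1` with derivative `c`, then `F'` has the radial limit `c` at `1`. -/
theorem LipschitzWith.tendsto_deriv_of_isLittleO {F : ℂ → ℂ} {C : NNReal}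
    (hL : LipschitzWith C F) (hF : DifferentiableOn ℂ F (Metric.ball 0 1)) {c : ℂ}
    (hc : (fun w ↦ F w - F 1 - c * (w - 1)) =o[𝓝[Metric.sphere 0 1] 1] fun w ↦ w - 1) :
    Tendsto (fun r : ℝ ↦ deriv F r) (𝓝[<] 1) (𝓝 c) := by
  -- Removing the first-order part at `1` reduces the claim to `H' → 0`, with `H = o(w - 1)` on the
  -- circle.
  set H : ℂ → ℂ := fun w ↦ F w - F 1 - c * (w - 1) with hH
  have hHd : DifferentiableOn ℂ H (Metric.ball 0 1) := by fun_prop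
  have hHc : Continuous H := by have := hL.continuous; fun_prop
  have hHcl : DiffContOnCl ℂ H (Metric.ball 0 1) := ⟨hHd, hHc.continuousOn⟩
  set B : ℝ := C + ‖c‖ with hB
  have hB0 : 0 ≤ B := by positivity
  have hHB : ∀ w, ‖H w‖ ≤ B * ‖w - 1‖ := by
    intro w
    calc ‖H w‖ ≤ ‖F w - F 1‖ + ‖c * (w - 1)‖ := _root_.norm_sub_le _ _
      _ ≤ C * ‖w - 1‖ + ‖c‖ * ‖w - 1‖ := by
        gcongr
        · simpa [dist_eq_norm] using hL.dist_le_mul w 1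
        · rw [norm_mul]
      _ = B * ‖w - 1‖ := by rw [hB]; ring
  have key : ∀ r : ℝ, 0 < r → r < 1 → ∀ ε > 0, ∀ δ > 0,
      (∀ w ∈ Metric.sphere (0 : ℂ) 1, ‖w - 1‖ < δ → ‖H w‖ ≤ ε * ‖w - 1‖) → 1 - r < δ / 2 →
      ‖deriv F r - c‖ ≤ 4 * ε + 16 * B / δ ^ 2 * (1 - r ^ 2) := by
    intro r hr0 hr1 ε hε δ hδ hs hrδ
    have hrn : ‖(r : ℂ)‖ = r := by simp [abs_of_pos hr0]
    have hrb : (r : ℂ) ∈ Metric.ball (0 : ℂ) 1 := by simpa [abs_of_pos hr0] using hr1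
    have hinv : ∀ w ∈ Metric.closedBall (0 : ℂ) 1, w - (r : ℂ)⁻¹ ≠ 0 := by
      intro w hw h0
      rw [sub_eq_zero] at h0
      rw [mem_closedBall_zero_iff, h0, norm_inv, hrn] at hw
      exact absurd ((one_lt_inv₀ hr0).2 hr1) (not_lt.2 hw)
    have hne : ∀ w ∈ Metric.sphere (0 : ℂ) 1, w - (r : ℂ) ≠ 0 := by
      intro w hw h0
      rw [sub_eq_zero] at h0
      rw [mem_sphere_zero_iff_norm, h0, hrn] at hw
      linarith
    have e1 : deriv H r = deriv F r - c := by
      have h1 : HasDerivAt F (deriv F r) r :=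
        (hF.differentiableAt (Metric.isOpen_ball.mem_nhds hrb)).hasDerivAt
      have : HasDerivAt H (deriv F r - c * 1) r :=
        (h1.sub_const (F 1)).sub (((hasDerivAt_id (r : ℂ)).sub_const 1).const_mul c)
      simpa using this.deriv
    have e2 := hHcl.circleAverage_inv_sq_mul hrb
    -- The pole `1/r` lies outside the closed disc and the integrand vanishes at `0`. Subtracting
    -- this null integral leaves a kernel that, multiplied by `|w - 1|`, is at most four times the
    -- Poisson kernel.
    have e3 : Real.circleAverage (fun w ↦ (w / (w - (r : ℂ)⁻¹) ^ 2) * H w) 0 1 = 0 := by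
      have : DiffContOnCl ℂ (fun w ↦ (w / (w - (r : ℂ)⁻¹) ^ 2) * H w) (Metric.ball 0 |1|) := by
        rw [abs_one]
        refine DiffContOnCl.smul (f := H) (c := fun w ↦ (w / (w - (r : ℂ)⁻¹) ^ 2)) ?_ hHcl
        refine DifferentiableOn.diffContOnCl ?_
        rw [closure_ball 0 one_ne_zero]
        refine DifferentiableOn.div (by fun_prop) (by fun_prop) fun w hw ↦ pow_ne_zero 2 (hinv w hw)
      simpa using this.circleAverage
    have hsub : ∀ w ∈ Metric.sphere (0 : ℂ) 1, w ∈ Metric.closedBall (0 : ℂ) 1 :=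
      fun w hw ↦ Metric.sphere_subset_closedBall hw
    have e4 : deriv F r - c = Real.circleAverage
        (fun w ↦ (w / (w - r) ^ 2 - w / (w - (r : ℂ)⁻¹) ^ 2) * H w) 0 1 := by
      have e5 : deriv H r = Real.circleAverage (fun w ↦ (w / (w - r) ^ 2) * H w) 0 1
          - Real.circleAverage (fun w ↦ (w / (w - (r : ℂ)⁻¹) ^ 2) * H w) 0 1 := by
        rw [e2, e3, sub_zero]
      rw [← e1, e5, ← Real.circleAverage_fun_sub]
      · simp only [sub_mul]
      · refine ContinuousOn.circleIntegrable zero_le_one (ContinuousOn.mul ?_ hHc.continuousOn)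
        exact ContinuousOn.div (by fun_prop) (by fun_prop) fun w hw ↦ pow_ne_zero 2 (hne w hw)
      · refine ContinuousOn.circleIntegrable zero_le_one (ContinuousOn.mul ?_ hHc.continuousOn)
        exact ContinuousOn.div (by fun_prop) (by fun_prop)
          fun w hw ↦ pow_ne_zero 2 (hinv w (hsub w hw))
    have hPint : CircleIntegrable (poissonKernel 0 (r : ℂ)) 0 1 :=
      (continuousOn_poissonKernel hrb).circleIntegrable zero_le_one
    have hP4 : CircleIntegrable (fun w ↦ (4 * ε) • poissonKernel 0 (r : ℂ) w) 0 1 :=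
      hPint.const_smul
    have hr2 : r ^ 2 ≤ 1 := by nlinarith
    rw [e4]
    refine (norm_circleAverage_le (u := fun w ↦ (4 * ε) • poissonKernel 0 (r : ℂ) w
      + 16 * B / δ ^ 2 * (1 - r ^ 2)) (hP4.add (circleIntegrable_const _ _ _)) ?_).trans ?_
    · intro w hw
      rw [abs_one] at hw
      have hw1 : ‖w‖ = 1 := by simpa using hw
      have hk := norm_cauchyKernel_sub_reflection_mul_le hr0 hr1 hw1
      have hP0 : 0 ≤ poissonKernel 0 (r : ℂ) w := by
        rw [poissonKernel_def, sub_zero, sub_zero, hw1, hrn]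
        exact div_nonneg (by nlinarith) (by positivity)
      rw [norm_mul, smul_eq_mul]
      -- Near `1` the smallness of `H` is used and the Poisson kernel has mean one; away from `1`
      -- the Poisson kernel itself is `O(1 - r ^ 2)`.
      by_cases hwδ : ‖w - 1‖ < δ
      · calc _ ≤ ‖w / (w - r) ^ 2 - w / (w - (r : ℂ)⁻¹) ^ 2‖ * (ε * ‖w - 1‖) := by
              gcongr; exact hs w hw hwδ
          _ = ε * (‖w / (w - r) ^ 2 - w / (w - (r : ℂ)⁻¹) ^ 2‖ * ‖w - 1‖) := by ring
          _ ≤ ε * (4 * poissonKernel 0 (r : ℂ) w) := by gcongr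
          _ = 4 * ε * poissonKernel 0 (r : ℂ) w + 0 := by ring
          _ ≤ _ := by gcongr; exact mul_nonneg (by positivity) (by linarith)
      · have hd : δ / 2 ≤ ‖w - r‖ := by
          have h2 : ‖w - 1‖ ≤ ‖w - r‖ + ‖(r : ℂ) - 1‖ := by
            simpa using norm_add_le (w - r) ((r : ℂ) - 1)
          have h3 : ‖(r : ℂ) - 1‖ = 1 - r := by
            have : (r : ℂ) - 1 = ((r - 1 : ℝ) : ℂ) := by push_cast; ring
            rw [this, Complex.norm_real, Real.norm_eq_abs, abs_of_neg (by linarith)]; ring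
          linarith
        calc _ ≤ ‖w / (w - r) ^ 2 - w / (w - (r : ℂ)⁻¹) ^ 2‖ * (B * ‖w - 1‖) := by
              gcongr; exact hHB w
          _ = B * (‖w / (w - r) ^ 2 - w / (w - (r : ℂ)⁻¹) ^ 2‖ * ‖w - 1‖) := by ring
          _ ≤ B * (4 * poissonKernel 0 (r : ℂ) w) := by gcongr
          _ ≤ B * (4 * ((1 - r ^ 2) / (δ / 2) ^ 2)) := by
            rw [poissonKernel_def, sub_zero, sub_zero, hw1, hrn, one_pow]
            gcongr
          _ = 0 + 16 * B / δ ^ 2 * (1 - r ^ 2) := by field_simp; ring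
          _ ≤ _ := by gcongr; positivity
    · rw [Real.circleAverage_fun_add hP4 (circleIntegrable_const _ _ _),
        Real.circleAverage_fun_smul, circleAverage_poissonKernel hrb, Real.circleAverage_const]
      simp
  rw [Metric.tendsto_nhds]
  intro ε hε
  have h1 := hc.def (c := ε / 8) (by positivity)
  rw [eventually_nhdsWithin_iff, Metric.eventually_nhds_iff] at h1
  obtain ⟨δ, hδ, hs⟩ := h1
  have h2 : ∀ᶠ r : ℝ in 𝓝[<] 1, 16 * B / δ ^ 2 * (1 - r ^ 2) < ε / 2 := by
    have : Tendsto (fun r : ℝ ↦ 16 * B / δ ^ 2 * (1 - r ^ 2)) (𝓝[<] 1) (𝓝 0) := by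
      have h3 : Continuous fun r : ℝ ↦ 16 * B / δ ^ 2 * (1 - r ^ 2) := by fun_prop
      have h4 := h3.tendsto 1
      simp only [one_pow, sub_self, mul_zero] at h4
      exact h4.mono_left nhdsWithin_le_nhds
    exact this.eventually_lt_const (by positivity)
  have h3 : ∀ᶠ r : ℝ in 𝓝[<] 1, r ∈ Ioo (max 0 (1 - δ / 2)) 1 :=
    Ioo_mem_nhdsLT (by simp [hδ])
  filter_upwards [h2, h3] with r h2 h3
  have h4 := max_lt_iff.1 h3.1
  have := key r h4.1 h3.2 (ε / 8) (by positivity) δ hδ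
    (fun w hw hwδ ↦ hs (by rwa [dist_eq_norm]) hw) (by linarith [h4.2])
  rw [dist_eq_norm]
  linarith

/-- A holomorphic function on the unit disc which has a Lipschitz primitive has a radial limit at
every boundary point at which the primitive is differentiable along the circle. -/
theorem LipschitzWith.exists_radial_limit_of_differentiableAt {F g : ℂ → ℂ} {C : NNReal}
    (hL : LipschitzWith C F) (hF : ∀ z ∈ Metric.ball (0 : ℂ) 1, HasDerivAt F (g z) z) {θ : ℝ}
    (hd : DifferentiableAt ℝ (fun t : ℝ ↦ F (Complex.exp (t * Complex.I))) θ) :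
    ∃ w, Tendsto (fun r : ℝ ↦ g (r * Complex.exp (θ * Complex.I))) (𝓝[<] 1) (𝓝 w) := by
  set ζ := Complex.exp (θ * Complex.I) with hζ
  have hζ1 : ‖ζ‖ = 1 := Complex.norm_exp_ofReal_mul_I θ
  have hζ0 : ζ ≠ 0 := Complex.exp_ne_zero _
  set G : ℂ → ℂ := fun w ↦ F (ζ * w) with hG
  have hGL : LipschitzWith C G := by
    refine LipschitzWith.of_dist_le_mul fun x y ↦ ?_
    have := hL.dist_le_mul (ζ * x) (ζ * y)
    rwa [dist_eq_norm (ζ * x), ← mul_sub, norm_mul, hζ1, one_mul, ← dist_eq_norm] at this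
  have hball : ∀ z ∈ Metric.ball (0 : ℂ) 1, ζ * z ∈ Metric.ball (0 : ℂ) 1 := by
    intro z hz
    simpa [hζ1] using hz
  have hGd : ∀ z ∈ Metric.ball (0 : ℂ) 1, HasDerivAt G (g (ζ * z) * ζ) z := by
    intro z hz
    have h1 : HasDerivAt (fun w ↦ ζ * w) ζ z := by
      simpa using (hasDerivAt_id z).const_mul ζ
    exact (hF _ (hball z hz)).comp z h1
  have hGdiff : DifferentiableOn ℂ G (Metric.ball 0 1) :=
    fun z hz ↦ (hGd z hz).differentiableAt.differentiableWithinAt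
  obtain ⟨d, hd⟩ : ∃ d, HasDerivAt (fun t : ℝ ↦ F (Complex.exp (t * Complex.I))) d θ :=
    ⟨_, hd.hasDerivAt⟩
  have hd' : HasDerivAt (fun t : ℝ ↦ G (Complex.exp (t * Complex.I))) d 0 := by
    have h1 : HasDerivAt (fun t : ℝ ↦ F (Complex.exp (t * Complex.I))) d (θ + 0) := by
      simpa using hd
    have h2 := h1.comp_const_add θ 0
    refine h2.congr_of_eventuallyEq (Eventually.of_forall fun t ↦ ?_)
    simp only [hG, hζ, ← Complex.exp_add]
    congr 2
    push_cast
    ring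
  have he : HasDerivAt (fun t : ℝ ↦ Complex.exp (t * Complex.I)) Complex.I 0 := by
    have h1 : HasDerivAt (fun t : ℂ ↦ Complex.exp (t * Complex.I))
        (Complex.exp ((0 : ℝ) * Complex.I) * (1 * Complex.I)) ((0 : ℝ) : ℂ) :=
      ((hasDerivAt_id _).mul_const Complex.I).cexp
    simpa using h1.comp_ofReal
  -- At angle `0` the circle has velocity `i`, so `c` solves `c * i = d`.
  set c : ℂ := -Complex.I * d with hc
  have hdiff : HasDerivAt (fun t : ℝ ↦ G (Complex.exp (t * Complex.I))
      - c * Complex.exp (t * Complex.I)) 0 0 := by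
    have := hd'.sub (he.const_mul c)
    have h0 : d - c * Complex.I = 0 := by
      rw [hc]; linear_combination d * Complex.I_sq
    rwa [h0] at this
  have hlo := hdiff.isLittleO
  simp only [sub_zero, smul_zero, Complex.ofReal_zero, zero_mul, Complex.exp_zero, mul_one] at hlo
  -- Since `arg w = O(w - 1)`, an error `o(θ)` in the angle becomes `o(w - 1)` along the circle.
  have hlog : (fun w : ℂ ↦ Complex.log w) =O[𝓝 1] fun w ↦ w - 1 := by
    have := (Complex.hasStrictDerivAt_log (x := 1) (by simp)).hasDerivAt.isBigO_sub
    simpa using this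
  have harg : (fun w : ℂ ↦ w.arg) =O[𝓝 1] fun w ↦ w - 1 := by
    refine Asymptotics.IsBigO.trans
      (Asymptotics.IsBigO.of_bound 1 (Eventually.of_forall fun w ↦ ?_)) hlog
    rw [one_mul, ← Complex.log_im]
    exact Complex.abs_im_le_norm _
  have hargt : Tendsto Complex.arg (𝓝 1) (𝓝 0) := by
    have := (Complex.continuousAt_arg (x := 1) (by simp)).tendsto
    simpa using this
  have key := LipschitzWith.tendsto_deriv_of_isLittleO hGL hGdiff (c := c) (by
    have h1 := ((hlo.comp_tendsto hargt).trans_isBigO harg).mono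
      (nhdsWithin_le_nhds (s := Metric.sphere (0 : ℂ) 1))
    refine h1.congr' ?_ EventuallyEq.rfl
    filter_upwards [self_mem_nhdsWithin] with w hw
    have hw1 : ‖w‖ = 1 := by simpa using hw
    have hw2 : Complex.exp (w.arg * Complex.I) = w := by
      have := Complex.norm_mul_exp_arg_mul_I w
      rwa [hw1, Complex.ofReal_one, one_mul] at this
    simp only [Function.comp_apply, hw2]
    ring)
  refine ⟨c * ζ⁻¹, ?_⟩
  refine (key.mul_const ζ⁻¹).congr' ?_
  have hI : Ioo (0 : ℝ) 1 ∈ 𝓝[<] (1 : ℝ) := Ioo_mem_nhdsLT zero_lt_one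
  filter_upwards [hI] with r hr
  have hrb : (r : ℂ) ∈ Metric.ball (0 : ℂ) 1 := by simpa [abs_of_pos hr.1] using hr.2
  rw [(hGd r hrb).deriv, mul_assoc, mul_inv_cancel₀ hζ0, mul_one, mul_comm]

/-- **Fatou's theorem**: a bounded holomorphic function on the unit disc has radial limits almost
everywhere. -/
theorem DifferentiableOn.ae_exists_radial_limit_of_bounded {g : ℂ → ℂ} {M : ℝ}
    (hg : DifferentiableOn ℂ g (Metric.ball 0 1)) (hM : ∀ z ∈ Metric.ball (0 : ℂ) 1, ‖g z‖ ≤ M) :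
    ∀ᵐ θ : ℝ, ∃ w, Tendsto (fun r : ℝ ↦ g (r * Complex.exp (θ * Complex.I))) (𝓝[<] 1) (𝓝 w) := by
  obtain ⟨F, hF⟩ := hg.isExactOn_ball
  have hM0 : 0 ≤ M := (norm_nonneg _).trans (hM 0 (by simp))
  have hL : LipschitzOnWith M.toNNReal F (Metric.ball 0 1) := by
    refine Convex.lipschitzOnWith_of_nnnorm_deriv_le (fun z hz ↦ (hF z hz).differentiableAt) ?_
      (convex_ball _ _)
    intro z hz
    rw [(hF z hz).deriv, ← NNReal.coe_le_coe, coe_nnnorm, Real.coe_toNNReal _ hM0]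
    exact hM z hz
  -- The extension supplies Lipschitz boundary values, so the primitive is differentiable along the
  -- circle at almost every angle.
  obtain ⟨F', hL', hEq⟩ := hL.extend_finite_dimension
  have hF' : ∀ z ∈ Metric.ball (0 : ℂ) 1, HasDerivAt F' (g z) z := fun z hz ↦
    (hF z hz).congr_of_eventuallyEq
      (hEq.symm.eventuallyEq_of_mem (Metric.isOpen_ball.mem_nhds hz))
  have hcirc : LipschitzWith (Real.nnabs 1) fun t : ℝ ↦ Complex.exp (t * Complex.I) := by
    convert lipschitzWith_circleMap 0 1 using 1
    ext t
    simp [circleMap]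
  have := (hL'.comp hcirc).ae_differentiableAt_real
  filter_upwards [this] with θ hθ
  exact hL'.exists_radial_limit_of_differentiableAt hF' hθ

/-- A function which is holomorphic on the unit disc, with values in the right half-plane, has
finite radial limits almost everywhere. -/
theorem DifferentiableOn.ae_exists_radial_limit_of_re_pos {p : ℂ → ℂ}
    (hp : DifferentiableOn ℂ p (Metric.ball 0 1))
    (hre : ∀ z ∈ Metric.ball (0 : ℂ) 1, 0 < (p z).re) :
    ∀ᵐ θ : ℝ ∂(volume.restrict (Ioc 0 (2 * Real.pi))),
      ∃ w, Tendsto (fun r : ℝ ↦ p (r * Complex.exp (θ * Complex.I))) (𝓝[<] 1) (𝓝 w) := by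
  have h1 : ∀ z ∈ Metric.ball (0 : ℂ) 1, 1 ≤ ‖1 + p z‖ := by
    intro z hz
    have h2 := Complex.re_le_norm (1 + p z)
    have h3 := hre z hz
    simp only [Complex.add_re, Complex.one_re] at h2
    linarith
  have hne : ∀ z ∈ Metric.ball (0 : ℂ) 1, 1 + p z ≠ 0 := fun z hz h0 ↦ by
    have := h1 z hz
    rw [h0, norm_zero] at this
    linarith
  set g : ℂ → ℂ := fun z ↦ (1 + p z)⁻¹ with hg
  have hgd : DifferentiableOn ℂ g (Metric.ball 0 1) := (hp.const_add 1).inv hne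
  have hg1 : ∀ z ∈ Metric.ball (0 : ℂ) 1, ‖g z‖ ≤ 1 := fun z hz ↦ by
    rw [hg, norm_inv]
    exact inv_le_one_of_one_le₀ (h1 z hz)
  have hrad := ae_restrict_of_ae (s := Ioc 0 (2 * Real.pi))
    (hgd.ae_exists_radial_limit_of_bounded hg1)
  -- A radial limit of `p` is lost only where that of `g` is `0`. There `Re L = log |1 + p| ≥ 0`
  -- blows up, but its circle means all equal `Re L 0`, so Fatou's lemma makes such angles a null
  -- set.
  set L : ℂ → ℂ := fun z ↦ Complex.log (1 + p z) with hLdef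
  have hLd : DifferentiableOn ℂ L (Metric.ball 0 1) :=
    (hp.const_add 1).clog fun z hz ↦ Or.inl (by
      have := hre z hz
      simp only [Complex.add_re, Complex.one_re]
      linarith)
  have hLre : ∀ z, (L z).re = Real.log ‖1 + p z‖ := fun z ↦ Complex.log_re _
  set ρ : ℕ → ℝ := fun k ↦ 1 - 1 / ((k : ℝ) + 2) with hρ
  have hρ01 : ∀ k, ρ k ∈ Ioo (0 : ℝ) 1 := by
    intro k
    have h2 : (0 : ℝ) < 1 / ((k : ℝ) + 2) := by positivity
    have h3 : 1 / ((k : ℝ) + 2) < 1 := by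
      rw [div_lt_one (by positivity)]
      have : (0 : ℝ) ≤ k := k.cast_nonneg
      linarith
    exact ⟨by simp only [hρ]; linarith, by simp only [hρ]; linarith⟩
  have hρt : Tendsto ρ atTop (𝓝[<] 1) := by
    refine tendsto_nhdsWithin_iff.2 ⟨?_, Eventually.of_forall fun k ↦ (hρ01 k).2⟩
    have h2 : Tendsto (fun k : ℕ ↦ 1 / ((k : ℝ) + 2)) atTop (𝓝 0) :=
      Tendsto.div_atTop tendsto_const_nhds
        (tendsto_atTop_add_const_right _ _ tendsto_natCast_atTop_atTop)
    simpa [hρ] using h2.const_sub 1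
  have hmem : ∀ k (θ : ℝ), circleMap 0 (ρ k) θ ∈ Metric.ball (0 : ℂ) 1 := by
    intro k θ
    rw [mem_ball_zero_iff, norm_circleMap_zero, abs_of_pos (hρ01 k).1]
    exact (hρ01 k).2
  have hcont : ∀ k, Continuous fun θ : ℝ ↦ (L (circleMap 0 (ρ k) θ)).re := fun k ↦
    Complex.continuous_re.comp
      (hLd.continuousOn.comp_continuous (continuous_circleMap _ _) (hmem k))
  have hL0 : ∀ k (θ : ℝ), 0 ≤ (L (circleMap 0 (ρ k) θ)).re := fun k θ ↦ by
    rw [hLre]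
    exact Real.log_nonneg (h1 _ (hmem k θ))
  have hint : ∀ k, ∫ θ in Ioc 0 (2 * Real.pi), (L (circleMap 0 (ρ k) θ)).re
      = 2 * Real.pi * (L 0).re := by
    intro k
    have hcl : DiffContOnCl ℂ L (Metric.ball 0 |ρ k|) := by
      rw [abs_of_pos (hρ01 k).1]
      exact hLd.diffContOnCl_ball (Metric.closedBall_subset_ball (hρ01 k).2)
    have h2 := hcl.circleAverage
    have hci : CircleIntegrable L 0 (ρ k) := by
      refine ContinuousOn.circleIntegrable (hρ01 k).1.le (hLd.continuousOn.mono ?_)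
      exact Metric.sphere_subset_closedBall.trans (Metric.closedBall_subset_ball (hρ01 k).2)
    have h3 := Complex.reCLM.circleAverage_comp_comm hci
    rw [h2, Complex.reCLM_apply, Real.circleAverage, smul_eq_mul,
      intervalIntegral.integral_of_le Real.two_pi_pos.le] at h3
    rw [← h3]
    have := Real.two_pi_pos.ne'
    simp only [Function.comp_apply, Complex.reCLM_apply]
    field_simp
  have hlint : ∀ k, ∫⁻ θ in Ioc 0 (2 * Real.pi),
      ENNReal.ofReal (L (circleMap 0 (ρ k) θ)).re = ENNReal.ofReal (2 * Real.pi * (L 0).re) := by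
    intro k
    rw [← hint k, ofReal_integral_eq_lintegral_ofReal]
    · exact (hcont k).integrableOn_Ioc
    · exact Eventually.of_forall (hL0 k)
  have hmeas : ∀ k, Measurable fun θ : ℝ ↦ ENNReal.ofReal (L (circleMap 0 (ρ k) θ)).re :=
    fun k ↦ (hcont k).measurable.ennreal_ofReal
  have hfat : ∫⁻ θ in Ioc 0 (2 * Real.pi),
      liminf (fun k ↦ ENNReal.ofReal (L (circleMap 0 (ρ k) θ)).re) atTop ≠ ⊤ := by
    refine ne_top_of_le_ne_top ?_ (lintegral_liminf_le hmeas)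
    simp only [hlint, liminf_const]
    exact ENNReal.ofReal_ne_top
  have hfin := ae_lt_top (Measurable.liminf hmeas) hfat
  filter_upwards [hrad, hfin] with θ ⟨w, hw⟩ hθ
  have hw0 : w ≠ 0 := by
    rintro rfl
    refine hθ.ne (Tendsto.liminf_eq ?_)
    have h2 := hw.comp hρt
    have h3 : Tendsto (fun k ↦ ‖1 + p (circleMap 0 (ρ k) θ)‖) atTop atTop := by
      have h4 : Tendsto (fun k ↦ ‖g (circleMap 0 (ρ k) θ)‖) atTop (𝓝[>] 0) := by
        refine tendsto_nhdsWithin_iff.2 ⟨?_, Eventually.of_forall fun k ↦ ?_⟩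
        · simpa [circleMap_zero] using h2.norm
        · exact norm_pos_iff.2 (inv_ne_zero (hne _ (hmem k θ)))
      refine h4.inv_tendsto_nhdsGT_zero.congr fun k ↦ ?_
      simp [hg]
    have h5 := ENNReal.tendsto_ofReal_atTop.comp (Real.tendsto_log_atTop.comp h3)
    refine h5.congr fun k ↦ ?_
    simp only [Function.comp_apply, hLre]
  refine ⟨w⁻¹ - 1, ((hw.inv₀ hw0).sub_const 1).congr fun r ↦ ?_⟩
  simp [hg]

/-! ### The infinitesimal Schwarz–Pick inequality for left inverses. -/

namespace TubeGeodesic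

/-- Schwarz's lemma after the Möbius map sending `F 0` to `0`. Clearing the denominator keeps the
squared form easy to differentiate in a parameter. -/
theorem norm_sub_le_norm_mul_of_mapsTo_disc {F : ℂ → ℂ} (hF : DifferentiableOn ℂ F disc)
    (hm : MapsTo F disc disc) {l : ℂ} (hl : l ∈ disc) :
    ‖F l - F 0‖ ≤ ‖l‖ * ‖1 - star (F 0) * F l‖ := by
  have h0 : (0 : ℂ) ∈ disc := by simp [disc]
  have hlt : ∀ z ∈ disc, ‖F z - F 0‖ < ‖1 - star (F 0) * F z‖ := by
    intro z hz
    have h1 : ‖F z‖ < 1 := by simpa [disc] using hm hz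
    have h2 : ‖F 0‖ < 1 := by simpa [disc] using hm h0
    refine lt_of_pow_lt_pow_left₀ 2 (norm_nonneg _) ?_
    have h3 : ‖1 - star (F 0) * F z‖ ^ 2 - ‖F z - F 0‖ ^ 2
        = (1 - ‖F z‖ ^ 2) * (1 - ‖F 0‖ ^ 2) := by
      simp only [← Complex.normSq_eq_norm_sq, Complex.normSq_apply, Complex.sub_re, Complex.sub_im,
        Complex.mul_re, Complex.mul_im, Complex.star_def, Complex.conj_re, Complex.conj_im,
        Complex.one_re, Complex.one_im]
      ring
    have h4 : 0 < (1 - ‖F z‖ ^ 2) * (1 - ‖F 0‖ ^ 2) := by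
      have := norm_nonneg (F z)
      have := norm_nonneg (F 0)
      apply mul_pos <;> nlinarith
    linarith
  have hpos : ∀ z ∈ disc, 0 < ‖1 - star (F 0) * F z‖ := fun z hz ↦
    (norm_nonneg _).trans_lt (hlt z hz)
  have hd : DifferentiableOn ℂ (fun z ↦ (F z - F 0) / (1 - star (F 0) * F z)) disc :=
    (hF.sub_const _).div ((hF.const_mul _).const_sub 1) fun z hz ↦ norm_pos_iff.1 (hpos z hz)
  have hmaps : MapsTo (fun z ↦ (F z - F 0) / (1 - star (F 0) * F z)) (Metric.ball 0 1)
      (Metric.closedBall 0 1) := by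
    intro z hz
    rw [mem_closedBall_zero_iff, norm_div]
    exact ((div_lt_one (hpos z hz)).2 (hlt z hz)).le
  have := Complex.norm_le_norm_of_mapsTo_ball hd hmaps (by simp) (by simpa [disc] using hl)
  rwa [norm_div, div_le_iff₀ (hpos l hl)] at this

theorem complexGradient_dotProduct {n : ℕ} (f : (Fin n → ℂ) → ℂ) (z v : Fin n → ℂ) :
    complexGradient f z ⬝ᵥ v = fderiv ℂ f z v := by
  conv_rhs => rw [← Finset.univ_sum_single v, map_sum]
  refine Finset.sum_congr rfl fun j _ ↦ ?_
  have : (Pi.single j (v j) : Fin n → ℂ) = v j • Pi.single j 1 := by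
    rw [← Pi.single_smul, smul_eq_mul, mul_one]
  rw [this, map_smul, smul_eq_mul, mul_comm]
  rfl

/-- Schwarz–Pick along the segment from `φ` to `ψ` is sharp at `t = 0`, where the composite with `f`
is the identity; this is its first-order term. -/
theorem fderiv_left_inverse_generator {n : ℕ} {D : Set (Fin n → ℂ)} (hDo : IsOpen D)
    (hDc : Convex ℝ D) {φ ψ : ℂ → Fin n → ℂ} (hφ : IsHoloDisc D φ) (hψ : IsHoloDisc D ψ)
    {f : (Fin n → ℂ) → ℂ} (hf : IsLeftInverse D φ f) {l : ℂ} (hl : l ∈ disc) :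
    (star l * (fderiv ℂ f (φ l) (ψ l - φ l) - fderiv ℂ f (φ 0) (ψ 0 - φ 0)
      + star (fderiv ℂ f (φ 0) (ψ 0 - φ 0)) * l ^ 2)).re ≤ 0 := by
  have h0 : (0 : ℂ) ∈ disc := by simp [disc]
  set G : ℂ → ℂ := fun z ↦ fderiv ℂ f (φ z) (ψ z - φ z) with hG
  set u : ℂ → ℝ → ℂ := fun z t ↦ f (φ z + (t : ℂ) • (ψ z - φ z)) with hu
  have hu0 : ∀ z ∈ disc, u z 0 = z := fun z hz ↦ by simp [hu, hf.2 z hz]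
  have hmem : ∀ t ∈ Icc (0 : ℝ) 1, ∀ z ∈ disc, φ z + (t : ℂ) • (ψ z - φ z) ∈ D := by
    intro t ht z hz
    have h1 := hDc.add_smul_sub_mem (hφ.2 hz) (hψ.2 hz) ht
    rwa [← Complex.coe_smul] at h1
  have hder : ∀ z ∈ disc, HasDerivAt (u z) (G z) 0 := by
    intro z hz
    have h1 : HasFDerivAt f (fderiv ℂ f (φ z)) (φ z + ((0 : ℝ) : ℂ) • (ψ z - φ z)) := by
      simpa using (hf.1.1.differentiableAt (hDo.mem_nhds (hφ.2 hz))).hasFDerivAt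
    have h2 : HasDerivAt (fun s : ℂ ↦ φ z + s • (ψ z - φ z)) (ψ z - φ z) ((0 : ℝ) : ℂ) := by
      simpa using ((hasDerivAt_id ((0 : ℝ) : ℂ)).smul_const (ψ z - φ z)).const_add (φ z)
    exact (h1.comp_hasDerivAt _ h2).comp_ofReal
  have hineq : ∀ t ∈ Icc (0 : ℝ) 1, ‖u l t - u 0 t‖ ≤ ‖l‖ * ‖1 - star (u 0 t) * u l t‖ := by
    intro t ht
    refine norm_sub_le_norm_mul_of_mapsTo_disc (F := fun z ↦ u z t) ?_ ?_ hl
    · exact hf.1.1.comp (hφ.1.add ((hψ.1.sub hφ.1).const_smul (t : ℂ))) (hmem t ht)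
    · exact fun z hz ↦ hf.1.2 (hmem t ht z hz)
  -- `N` is nonnegative on `[0, 1]` and vanishes at `0`, so its derivative at `0` is nonnegative;
  -- that derivative is `-2` times the expression in the goal.
  set N : ℝ → ℝ := fun t ↦ ‖l‖ ^ 2 * ‖1 - star (u 0 t) * u l t‖ ^ 2 - ‖u l t - u 0 t‖ ^ 2 with hN
  have hstar : HasDerivAt (fun t ↦ star (u 0 t)) (star (G 0)) 0 := (hder 0 h0).star
  have hNd := (((((hstar.mul (hder l hl)).const_sub 1).norm_sq).const_mul (‖l‖ ^ 2)).sub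
    ((hder l hl).sub (hder 0 h0)).norm_sq)
  have hN0 : N 0 = 0 := by simp [hN, hu0 l hl, hu0 0 h0]
  have hNnn : ∀ t ∈ Icc (0 : ℝ) 1, 0 ≤ N t := by
    intro t ht
    have := pow_le_pow_left₀ (norm_nonneg _) (hineq t ht) 2
    rw [mul_pow] at this
    exact sub_nonneg.2 this
  have hlim := hNd.tendsto_slope_zero_right
  have hnn := ge_of_tendsto (b := (0 : ℝ)) hlim (by
    have : Ioo (0 : ℝ) 1 ∈ 𝓝[>] (0 : ℝ) := Ioo_mem_nhdsGT zero_lt_one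
    filter_upwards [this] with t ht
    have h1 := hNnn t ⟨ht.1.le, ht.2.le⟩
    change 0 ≤ t⁻¹ • (N (0 + t) - N 0)
    rw [zero_add, hN0, sub_zero]
    exact smul_nonneg (inv_nonneg.2 ht.1.le) h1)
  change (star l * (G l - G 0 + star (G 0) * l ^ 2)).re ≤ 0
  simp only [Pi.mul_apply, Pi.sub_apply, hu0 l hl, hu0 0 h0, star_zero, zero_mul, sub_zero, Complex.inner,
    ← Complex.normSq_eq_norm_sq, Complex.normSq_apply] at hnn
  simp only [Complex.star_def, Complex.mul_re, Complex.mul_im, Complex.add_re, Complex.add_im,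
    Complex.sub_re, Complex.sub_im, Complex.conj_re, Complex.conj_im, pow_two, map_one,
    Complex.one_re, Complex.one_im, Complex.neg_re, Complex.neg_im, mul_zero, Complex.zero_re] at hnn ⊢
  linarith

/-- Difference quotients in the direction `v` are holomorphic in `l`, and converge locally uniformly
because `f` is bounded. -/
theorem differentiableOn_fderiv_comp {n : ℕ} {D : Set (Fin n → ℂ)} (hDo : IsOpen D)
    {φ : ℂ → Fin n → ℂ} (hφ : IsHoloDisc D φ) {f : (Fin n → ℂ) → ℂ} (hf : IsHoloToDisc D f)
    (v : Fin n → ℂ) : DifferentiableOn ℂ (fun l ↦ fderiv ℂ f (φ l) v) disc := by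
  intro l₀ hl₀
  have hdo : IsOpen disc := Metric.isOpen_ball
  obtain ⟨δ, hδ, hδD⟩ := Metric.isOpen_iff.1 hDo _ (hφ.2 hl₀)
  have hc : ContinuousAt φ l₀ := hφ.1.continuousOn.continuousAt (hdo.mem_nhds hl₀)
  obtain ⟨ε, hε, hεs⟩ := Metric.mem_nhds_iff.1
    (inter_mem (hdo.mem_nhds hl₀) (hc (Metric.ball_mem_nhds _ (half_pos hδ))))
  set U := Metric.ball l₀ ε with hU
  set ρ : ℝ := δ / (2 * (‖v‖ + 1)) with hρ
  have hρ0 : 0 < ρ := by positivity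
  have hmem : ∀ l ∈ U, ∀ s ∈ Metric.ball (0 : ℂ) ρ, φ l + s • v ∈ D := by
    intro l hl s hs
    refine hδD ?_
    have h1 : dist (φ l) (φ l₀) < δ / 2 := (hεs hl).2
    have h2 : ‖s • v‖ ≤ δ / 2 := by
      rw [norm_smul]
      have h3 : ‖s‖ ≤ ρ := (mem_ball_zero_iff.1 hs).le
      calc ‖s‖ * ‖v‖ ≤ ρ * (‖v‖ + 1) := by gcongr; linarith
        _ = δ / 2 := by rw [hρ]; field_simp
    rw [Metric.mem_ball, dist_eq_norm] at *
    calc ‖φ l + s • v - φ l₀‖ = ‖(φ l - φ l₀) + s • v‖ := by congr 1; abel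
      _ ≤ ‖φ l - φ l₀‖ + ‖s • v‖ := norm_add_le _ _
      _ < δ := by linarith
  have hball0 : (0 : ℂ) ∈ Metric.ball (0 : ℂ) ρ := Metric.mem_ball_self hρ0
  have hslice : ∀ l ∈ U, DifferentiableOn ℂ (fun s : ℂ ↦ f (φ l + s • v)) (Metric.ball 0 ρ) :=
    fun l hl ↦ hf.1.comp (by fun_prop) (hmem l hl)
  have hest : ∀ l ∈ U, ∀ s ∈ Metric.ball (0 : ℂ) ρ, s ≠ 0 →
      dist (fderiv ℂ f (φ l) v) (s⁻¹ * (f (φ l + s • v) - f (φ l))) ≤ 4 / ρ / ρ * ‖s‖ := by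
    intro l hl s hs hs0
    set k : ℂ → ℂ := fun s ↦ f (φ l + s • v) with hk
    have hkd := hslice l hl
    have hφl : φ l ∈ D := hφ.2 (hεs hl).1
    have hk0 : HasDerivAt k (fderiv ℂ f (φ l) v) 0 := by
      have h1 : HasFDerivAt f (fderiv ℂ f (φ l)) (φ l + (0 : ℂ) • v) := by
        simpa using (hf.1.differentiableAt (hDo.mem_nhds hφl)).hasFDerivAt
      have h2 : HasDerivAt (fun s : ℂ ↦ φ l + s • v) v 0 := by
        simpa using ((hasDerivAt_id (0 : ℂ)).smul_const v).const_add (φ l)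
      exact h1.comp_hasDerivAt _ h2
    have hd0 : dslope k 0 0 = fderiv ℂ f (φ l) v := by rw [dslope_same, hk0.deriv]
    have hds : dslope k 0 s = s⁻¹ * (f (φ l + s • v) - f (φ l)) := by
      rw [dslope_of_ne _ hs0, slope_def_module]
      simp [hk]
    -- Schwarz is applied twice: to `k`, which varies by at most `2`, bounding `dslope k 0` by `2 /
    -- ρ`; then to `dslope k 0`, which varies by at most `4 / ρ`. The resulting rate is independent
    -- of `l`.
    have hdd : DifferentiableOn ℂ (dslope k 0) (Metric.ball 0 ρ) :=
      (Complex.differentiableOn_dslope (Metric.ball_mem_nhds _ hρ0)).2 hkd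
    have hb : ∀ z ∈ D, ‖f z‖ ≤ 1 := fun z hz ↦ by
      have := hf.2 hz
      simp only [disc, mem_ball_zero_iff] at this
      exact this.le
    have hkm : MapsTo k (Metric.ball 0 ρ) (Metric.closedBall (k 0) 2) := by
      intro t ht
      rw [Metric.mem_closedBall, dist_eq_norm]
      refine (norm_sub_le _ _).trans ?_
      have h1 := hb _ (hmem l hl t ht)
      have h2 := hb _ (hmem l hl 0 hball0)
      simp only [hk]
      linarith
    have hdb : ∀ t ∈ Metric.ball (0 : ℂ) ρ, ‖dslope k 0 t‖ ≤ 2 / ρ := fun t ht ↦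
      Complex.norm_dslope_le_div_of_mapsTo_ball hkd hkm ht
    have hdm : MapsTo (dslope k 0) (Metric.ball 0 ρ)
        (Metric.closedBall (dslope k 0 0) (4 / ρ)) := by
      intro t ht
      rw [Metric.mem_closedBall, dist_eq_norm]
      refine (norm_sub_le _ _).trans ?_
      have h1 := hdb t ht
      have h2 := hdb 0 hball0
      have h3 : 4 / ρ = 2 / ρ + 2 / ρ := by ring
      linarith
    have := Complex.dist_le_div_mul_dist_of_mapsTo_ball hdd hdm hs
    rwa [dist_comm, hd0, hds, dist_zero_right] at this
  have hconv : TendstoUniformlyOn (fun (s : ℂ) l ↦ s⁻¹ * (f (φ l + s • v) - f (φ l)))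
      (fun l ↦ fderiv ℂ f (φ l) v) (𝓝[≠] 0) U := by
    rw [Metric.tendstoUniformlyOn_iff]
    intro η hη
    have h1 : ∀ᶠ s : ℂ in 𝓝[≠] 0, 4 / ρ / ρ * ‖s‖ < η := by
      have h2 : Continuous fun s : ℂ ↦ 4 / ρ / ρ * ‖s‖ := by fun_prop
      have h3 := h2.tendsto 0
      simp only [norm_zero, mul_zero] at h3
      exact (h3.mono_left nhdsWithin_le_nhds).eventually_lt_const hη
    filter_upwards [h1, self_mem_nhdsWithin,
      mem_nhdsWithin_of_mem_nhds (Metric.ball_mem_nhds _ hρ0)] with s hs1 hs2 hs3 l hl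
    exact (hest l hl s hs3 hs2).trans_lt hs1
  have hφU : DifferentiableOn ℂ φ U := hφ.1.mono fun l hl ↦ (hεs hl).1
  have hres : DifferentiableOn ℂ (fun l ↦ fderiv ℂ f (φ l) v) U := by
    refine hconv.tendstoLocallyUniformlyOn.differentiableOn ?_ Metric.isOpen_ball
    filter_upwards [mem_nhdsWithin_of_mem_nhds (Metric.ball_mem_nhds _ hρ0)] with s hs
    refine DifferentiableOn.const_mul (DifferentiableOn.sub ?_ ?_) _
    · exact hf.1.comp (hφU.add_const _) fun l hl ↦ hmem l hl s hs
    · exact hf.1.comp hφU fun l hl ↦ hφ.2 (hεs hl).1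
  exact (hres.differentiableAt (Metric.ball_mem_nhds _ hε)).differentiableWithinAt

/-! ### Rigidity in the equality case, and strictness. -/

/-- As `star l * l` is real, the quotient of the bracket by `l` is a holomorphic function with zero
real part, hence an imaginary constant `b * I`. -/
theorem exists_eq_quadratic {k : ℂ → ℂ} (hk : DifferentiableOn ℂ k disc)
    (h : ∀ l ∈ disc, (star l * (Complex.I * k l - Complex.I * k 0
      + star (Complex.I * k 0) * l ^ 2)).re = 0) :
    ∃ b : ℝ, ∀ l ∈ disc, k l = star (k 0) * l ^ 2 + b * l + k 0 := by
  have hdo : IsOpen disc := Metric.isOpen_ball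
  have h0 : (0 : ℂ) ∈ disc := by simp [disc]
  set q : ℂ → ℂ := fun l ↦ Complex.I * k l - Complex.I * k 0 + star (Complex.I * k 0) * l ^ 2
  have hq : DifferentiableOn ℂ q disc := by fun_prop
  have hq0 : q 0 = 0 := by simp [q]
  have hs : DifferentiableOn ℂ (dslope q 0) disc :=
    (Complex.differentiableOn_dslope (hdo.mem_nhds h0)).2 hq
  have hqs : ∀ l, q l = l * dslope q 0 l := by
    intro l
    have := sub_smul_dslope q 0 l
    rw [hq0, sub_zero, sub_zero, smul_eq_mul] at this
    exact this.symm
  have hre : ∀ l ∈ disc, l ≠ 0 → (dslope q 0 l).re = 0 := by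
    intro l hl hl0
    have h1 : (star l * q l).re = 0 := h l hl
    have h2 : star l * q l = ((‖l‖ ^ 2 : ℝ) : ℂ) * dslope q 0 l := by
      rw [hqs l, ← mul_assoc, mul_comm (star l), Complex.star_def, Complex.mul_conj,
        Complex.normSq_eq_norm_sq]
    rw [h2, Complex.re_ofReal_mul] at h1
    have : ‖l‖ ^ 2 ≠ 0 := pow_ne_zero 2 (norm_ne_zero_iff.2 hl0)
    exact (mul_eq_zero.1 h1).resolve_left this
  have hre0 : (dslope q 0 0).re = 0 := by
    have h1 : Tendsto (fun l ↦ (dslope q 0 l).re) (𝓝[≠] 0) (𝓝 (dslope q 0 0).re) :=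
      (Complex.continuous_re.continuousAt.comp
        (hs.continuousOn.continuousAt (hdo.mem_nhds h0))).tendsto.mono_left nhdsWithin_le_nhds
    refine tendsto_nhds_unique_of_eventuallyEq h1 tendsto_const_nhds ?_
    filter_upwards [self_mem_nhdsWithin, mem_nhdsWithin_of_mem_nhds (hdo.mem_nhds h0)] with l h1 h2
    exact hre l h2 h1
  obtain ⟨b, hb⟩ := (hs.analyticOnNhd hdo).eq_re_add_const_mul_I_of_re_eq_const (c₀ := 0)
    (fun l hl ↦ by
      rcases eq_or_ne l 0 with rfl | hl0
      · exact hre0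
      · exact hre l hl hl0) hdo (Metric.isConnected_ball one_pos)
  refine ⟨b, fun l hl ↦ ?_⟩
  have h1 : Complex.I * k l - Complex.I * k 0 + star (Complex.I * k 0) * l ^ 2
      = l * (((0 : ℝ) : ℂ) + b * Complex.I) := by
    rw [← hb l hl]; exact hqs l
  rw [star_mul, Complex.star_def, Complex.conj_I, Complex.ofReal_zero, zero_add] at h1
  rw [Complex.star_def]
  refine mul_left_cancel₀ Complex.I_ne_zero ?_
  linear_combination h1

theorem re_neg_of_re_nonpos {m : ℂ → ℂ} (hm : DifferentiableOn ℂ m disc)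
    (hle : ∀ l ∈ disc, (m l).re ≤ 0) (h0 : (m 0).re < 0) {l : ℂ} (hl : l ∈ disc) :
    (m l).re < 0 := by
  have hdo : IsOpen disc := Metric.isOpen_ball
  have hmem : (0 : ℂ) ∈ disc := by simp [disc]
  rcases (hm.analyticOnNhd hdo).is_constant_or_isOpen
    (Metric.isConnected_ball one_pos).isPreconnected with ⟨w, hw⟩ | ho
  · rwa [hw l hl, ← hw 0 hmem]
  · have h1 : IsOpen (Complex.re '' (m '' disc)) := Complex.isOpenMap_re _ (ho disc subset_rfl hdo)
    have h2 : Complex.re '' (m '' disc) ⊆ interior (Iic 0) := by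
      refine interior_maximal ?_ h1
      rintro _ ⟨_, ⟨z, hz, rfl⟩, rfl⟩
      exact hle z hz
    rw [interior_Iic] at h2
    exact h2 ⟨_, ⟨l, hl, rfl⟩, rfl⟩

/-! ### Tautness and radial limits of discs in the tube. -/

/-- On a line in `Ω`, the discs `l ↦ x + k l v` all pass through `x` at `l = 0` but escape to
infinity at `l = 1/2`, so neither alternative of tautness can hold. -/
theorem exists_add_smul_notMem_of_isTaut {n : ℕ} {Ω : Set (Fin n → ℝ)}
    (hT : IsTaut {z : Fin n → ℂ | (fun j ↦ (z j).re) ∈ Ω}) {x : Fin n → ℝ} (hx : x ∈ Ω)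
    {v : Fin n → ℝ} (hv : v ≠ 0) : ∃ t : ℝ, x + t • v ∉ Ω := by
  by_contra! hline
  obtain ⟨j, hj⟩ := Function.ne_iff.1 hv
  have h0 : (0 : ℂ) ∈ disc := by simp [disc]
  have h2 : (1 / 2 : ℂ) ∈ disc := by
    simp only [disc, mem_ball_zero_iff]
    norm_num
  set F : ℕ → ℂ → Fin n → ℂ := fun k l i ↦ x i + k * l * v i with hF
  have hFD : ∀ k, IsHoloDisc {z : Fin n → ℂ | (fun j ↦ (z j).re) ∈ Ω} (F k) := by
    intro k
    refine ⟨differentiableOn_pi.2 fun i ↦ by fun_prop, fun l _ ↦ ?_⟩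
    have := hline (k * l.re)
    change (fun i ↦ (F k l i).re) ∈ Ω
    convert this using 1
    ext i
    simp [hF]
  obtain ⟨σ, hσ, ⟨g, -, hg⟩ | hdiv⟩ := hT F hFD
  · have h3 := (tendsto_pi_nhds.1 (hg.tendsto_at h2) j).norm
    have h4 : Tendsto (fun k ↦ ‖F (σ k) (1 / 2) j‖) atTop atTop := by
      have h5 : Tendsto (fun k : ℕ ↦ (σ k : ℝ) * (|v j| / 2) - |x j|) atTop atTop :=
        tendsto_atTop_add_const_right _ _
          ((tendsto_natCast_atTop_atTop.comp hσ.tendsto_atTop).atTop_mul_const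
            (half_pos (abs_pos.2 hj)))
      refine tendsto_atTop_mono (fun k ↦ ?_) h5
      have h6 := norm_sub_norm_le ((σ k : ℂ) * (1 / 2) * v j) (-(x j : ℂ))
      rw [norm_neg, sub_neg_eq_add, norm_mul, norm_mul, Complex.norm_real, Complex.norm_real,
        Complex.norm_natCast] at h6
      simp only [hF]
      rw [add_comm (x j : ℂ)]
      refine le_trans (le_of_eq ?_) h6
      norm_num
      ring
    exact not_tendsto_atTop_of_tendsto_nhds h3 h4
  · have h3 := hdiv {0} {fun i ↦ (x i : ℂ)} isCompact_singleton (by simpa using h0)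
      isCompact_singleton (by simpa using hx)
    obtain ⟨k, hk⟩ := h3.exists
    refine Set.disjoint_left.1 hk ⟨0, rfl, rfl⟩ ?_
    ext i
    simp [hF]

/-- The linear functionals which are bounded above on an open convex set that contains no line
span the dual space. -/
theorem span_bddAbove_eq_top {n : ℕ} {Ω : Set (Fin n → ℝ)} (hΩ : IsOpen Ω) (hne : Ω.Nonempty)
    (hc : Convex ℝ Ω) (hline : ∀ x ∈ Ω, ∀ v : Fin n → ℝ, v ≠ 0 → ∃ t : ℝ, x + t • v ∉ Ω) :
    Submodule.span ℝ {ℓ : Module.Dual ℝ (Fin n → ℝ) | ∃ M, ∀ x ∈ Ω, ℓ x < M} = ⊤ := by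
  by_contra hlt
  obtain ⟨e, he, hle⟩ := Submodule.exists_le_ker_of_lt_top _ (lt_top_iff_ne_top.2 hlt)
  -- By reflexivity the annihilating functional is evaluation at some `v`. Separating `Ω` from a
  -- point `x + t • v` outside it gives a bounded `ℓ` with `ℓ v = 0`, whence `ℓ x < ℓ x`.
  obtain ⟨v, rfl⟩ := (Module.evalEquiv ℝ (Fin n → ℝ)).surjective e
  have hv : v ≠ 0 := by
    rintro rfl
    exact he (map_zero _)
  obtain ⟨x, hx⟩ := hne
  obtain ⟨t, ht⟩ := hline x hx v hv
  obtain ⟨ℓ, hℓ⟩ := geometric_hahn_banach_open_point hc hΩ ht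
  have h1 : (ℓ : Module.Dual ℝ (Fin n → ℝ)) v = 0 :=
    hle (Submodule.subset_span ⟨ℓ (x + t • v), hℓ⟩)
  have h2 := hℓ x hx
  have h3 : ℓ v = 0 := h1
  simp [h3] at h2

/-- For `ℓ < M` on `Ω` the function `M - ℓ ∘ φ` lies in the right half-plane. Existence of limits is
stable under linear combinations, so it reaches the coordinate functionals. -/
theorem ae_exists_isRadialLimit {n : ℕ} {Ω : Set (Fin n → ℝ)} {φ : ℂ → Fin n → ℂ}
    (hφ : IsHoloDisc {z : Fin n → ℂ | (fun j ↦ (z j).re) ∈ Ω} φ)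
    (hspan : Submodule.span ℝ {ℓ : Module.Dual ℝ (Fin n → ℝ) | ∃ M, ∀ x ∈ Ω, ℓ x < M} = ⊤) :
    AEOnCircle fun ζ ↦ ∃ w, IsRadialLimit φ ζ w := by
  have key : ∀ ℓ : Module.Dual ℝ (Fin n → ℝ), ∀ᵐ θ : ℝ ∂(volume.restrict (Ioc 0 (2 * Real.pi))),
      ∃ w, Tendsto (fun r : ℝ ↦ ∑ j, (ℓ (Pi.single j 1) : ℂ) *
        φ (r * Complex.exp (θ * Complex.I)) j) (𝓝[<] 1) (𝓝 w) := by
    intro ℓ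
    have hmem : ℓ ∈ Submodule.span ℝ {ℓ : Module.Dual ℝ (Fin n → ℝ) | ∃ M, ∀ x ∈ Ω, ℓ x < M} := by
      rw [hspan]; trivial
    induction hmem using Submodule.span_induction with
    | mem ℓ hℓ =>
      obtain ⟨M, hM⟩ := hℓ
      have hd : DifferentiableOn ℂ (fun z ↦ (M : ℂ) - ∑ j, (ℓ (Pi.single j 1) : ℂ) * φ z j)
          (Metric.ball 0 1) := by
        refine DifferentiableOn.const_sub (DifferentiableOn.fun_sum fun j _ ↦ ?_) _
        exact (differentiableOn_pi.1 hφ.1 j).const_mul _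
      have hre : ∀ z ∈ Metric.ball (0 : ℂ) 1,
          0 < ((M : ℂ) - ∑ j, (ℓ (Pi.single j 1) : ℂ) * φ z j).re := by
        intro z hz
        have h1 := hM _ (hφ.2 hz)
        rw [LinearMap.pi_apply_eq_sum_univ] at h1
        simp only [Complex.sub_re, Complex.ofReal_re, Complex.re_sum, Complex.re_ofReal_mul]
        have h2 : ∑ j, ℓ (Pi.single j 1) * (φ z j).re
            = ∑ j, (φ z j).re • ℓ (fun i ↦ if j = i then 1 else 0) := by
          refine Finset.sum_congr rfl fun j _ ↦ ?_
          rw [smul_eq_mul, mul_comm]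
          congr 2
          ext i
          simp [Pi.single_apply, eq_comm]
        rw [h2]
        linarith
      filter_upwards [hd.ae_exists_radial_limit_of_re_pos hre] with θ ⟨w, hw⟩
      exact ⟨M - w, (hw.const_sub (M : ℂ)).congr fun r ↦ by simp⟩
    | zero => exact Eventually.of_forall fun θ ↦ ⟨0, by simp⟩
    | add ℓ₁ ℓ₂ _ _ h1 h2 =>
      filter_upwards [h1, h2] with θ ⟨w₁, hw₁⟩ ⟨w₂, hw₂⟩
      refine ⟨w₁ + w₂, (hw₁.add hw₂).congr fun r ↦ ?_⟩
      rw [← Finset.sum_add_distrib]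
      refine Finset.sum_congr rfl fun j _ ↦ ?_
      simp [add_mul]
    | smul a ℓ _ h =>
      filter_upwards [h] with θ ⟨w, hw⟩
      refine ⟨a * w, (hw.const_mul (a : ℂ)).congr fun r ↦ ?_⟩
      rw [Finset.mul_sum]
      refine Finset.sum_congr rfl fun j _ ↦ ?_
      simp [mul_assoc]
  have hall := ae_all_iff.2 fun j ↦ key (LinearMap.proj j)
  filter_upwards [hall] with θ hθ
  choose w hw using hθ
  refine ⟨w, tendsto_pi_nhds.2 fun j ↦ (hw j).congr fun r ↦ ?_⟩
  rw [Finset.sum_eq_single j]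
  · simp
  · intro i _ hij
    simp [hij.symm]
  · simp

theorem aeOnCircle_quadMap_ne_zero {n : ℕ} {a : Fin n → ℂ} {b : Fin n → ℝ} {l : ℂ}
    (hl : quadMap a b l ≠ 0) : AEOnCircle fun ζ ↦ quadMap a b ζ ≠ 0 := by
  obtain ⟨j, hj⟩ := Function.ne_iff.1 hl
  set P : Polynomial ℂ := Polynomial.C (star (a j)) * Polynomial.X ^ 2
    + Polynomial.C (b j : ℂ) * Polynomial.X + Polynomial.C (a j) with hP
  have hev : ∀ ζ, P.eval ζ = quadMap a b ζ j := fun ζ ↦ by simp [hP, quadMap]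
  have hP0 : P ≠ 0 := by
    intro h
    apply hj
    rw [← hev, h]
    simp
  have hfin : {ζ : ℂ | P.IsRoot ζ}.Finite := Polynomial.finite_setOfPred_isRoot hP0
  have hinj : InjOn (fun θ : ℝ ↦ Complex.exp (θ * Complex.I)) (Ioc 0 (2 * Real.pi)) := by
    have := injOn_circleMap_of_abs_sub_le (c := 0) (R := 1) (a := 0) (b := 2 * Real.pi)
      one_ne_zero (by simp [abs_of_pos Real.pi_pos])
    rw [uIoc_of_le Real.two_pi_pos.le] at this
    refine this.congr fun θ _ ↦ ?_
    simp [circleMap]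
  have hnull : volume (Ioc 0 (2 * Real.pi) ∩
      (fun θ : ℝ ↦ Complex.exp (θ * Complex.I)) ⁻¹' {ζ : ℂ | P.IsRoot ζ}) = 0 := by
    refine Set.Finite.measure_zero ?_ _
    refine Set.Finite.of_finite_image (f := fun θ : ℝ ↦ Complex.exp (θ * Complex.I)) ?_
      (hinj.mono inter_subset_left)
    exact hfin.subset (by rintro _ ⟨θ, hθ, rfl⟩; exact hθ.2)
  rw [AEOnCircle, ae_restrict_iff' measurableSet_Ioc, ae_iff]
  refine measure_mono_null (fun θ hθ ↦ ?_) hnull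
  simp only [mem_ofPred_eq, Classical.not_imp, not_not] at hθ
  refine ⟨hθ.1, ?_⟩
  simp [Polynomial.IsRoot, hev, hθ.2]

end TubeGeodesic

/-! ### Test discs and the proof of the theorem. -/

theorem mainTheorem6 {n : ℕ} (D : Set (Fin n → ℂ))
    (hD : TubeGeodesic.IsConvexTube D) (hT : TubeGeodesic.IsTaut D)
    (φ : ℂ → Fin n → ℂ) (hφ : TubeGeodesic.IsComplexGeodesic D φ)
    (f : (Fin n → ℂ) → ℂ) (hf : TubeGeodesic.IsLeftInverse D φ f)
    (h : ℂ → Fin n → ℂ)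
    (hh : ∀ l ∈ TubeGeodesic.disc, h l = TubeGeodesic.complexGradient f (φ l)) :
    ∃ (a : Fin n → ℂ) (b : Fin n → ℝ),
      (∀ l ∈ TubeGeodesic.disc, h l = TubeGeodesic.quadMap a b l) ∧
      (∃ l ∈ TubeGeodesic.disc, h l ≠ 0) ∧
      TubeGeodesic.AEOnCircle (fun l => ∃ w : Fin n → ℂ, TubeGeodesic.IsRadialLimit φ l w ∧
        ∀ z ∈ D, (star l * (TubeGeodesic.quadMap a b l ⬝ᵥ (z - w))).re < 0) ∧
      (∀ l ∈ TubeGeodesic.disc, l ≠ 0 → (h l ⬝ᵥ (l⁻¹ • (φ 0 - φ l))).re < 0) := by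
  open TubeGeodesic in
  obtain ⟨Ω, hΩo, hΩne, hΩc, rfl⟩ := hD
  set D : Set (Fin n → ℂ) := {z | (fun j => (z j).re) ∈ Ω} with hD
  have hφD : IsHoloDisc D φ := hφ.1
  have hdo : IsOpen disc := Metric.isOpen_ball
  have h0 : (0 : ℂ) ∈ disc := by simp [disc]
  have hDo : IsOpen D := hΩo.preimage (by fun_prop)
  have hDc : Convex ℝ D := by
    intro z hz w hw s t hs ht hst
    have := hΩc hz hw hs ht hst
    change (fun j ↦ ((s • z + t • w) j).re) ∈ Ω
    convert this using 1
    ext j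
    simp
  have hpair : ∀ l ∈ disc, ∀ v, h l ⬝ᵥ v = fderiv ℂ f (φ l) v := fun l hl v ↦ by
    rw [hh l hl, complexGradient_dotProduct]
  have hgen : ∀ ψ, IsHoloDisc D ψ → ∀ l ∈ disc, (star l * (h l ⬝ᵥ (ψ l - φ l)
      - h 0 ⬝ᵥ (ψ 0 - φ 0) + star (h 0 ⬝ᵥ (ψ 0 - φ 0)) * l ^ 2)).re ≤ 0 := by
    intro ψ hψ l hl
    rw [hpair l hl, hpair 0 h0]
    exact fderiv_left_inverse_generator hDo hDc hφD hψ hf hl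
  have hhd : ∀ j, DifferentiableOn ℂ (fun l ↦ h l j) disc := by
    intro j
    refine (differentiableOn_fderiv_comp hDo hφD hf.1 (Pi.single j 1)).congr fun l hl ↦ ?_
    simp only [hh l hl, complexGradient]
  have htrans : ∀ (j : Fin n) (s : ℝ),
      IsHoloDisc D fun l ↦ φ l + Pi.single j ((s : ℂ) * Complex.I) := by
    refine fun j s ↦ ⟨hφD.1.add_const _, fun l hl ↦ ?_⟩
    have : (fun i ↦ (φ l i).re) ∈ Ω := hφD.2 hl
    change (fun i ↦ ((φ l + Pi.single j ((s : ℂ) * Complex.I) : Fin n → ℂ) i).re) ∈ Ω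
    convert this using 1
    ext i
    rcases eq_or_ne i j with rfl | hij
    · simp
    · simp [hij]
  have hquad : ∀ j, ∃ b : ℝ, ∀ l ∈ disc, h l j = star (h 0 j) * l ^ 2 + b * l + h 0 j := by
    intro j
    refine exists_eq_quadratic (hhd j) fun l hl ↦ ?_
    -- The inequality is real-linear in `ψ - φ`, so the opposite translations `± i eⱼ` together
    -- force equality.
    have h1 := hgen _ (htrans j 1) l hl
    have h2 := hgen _ (htrans j (-1)) l hl
    simp only [add_sub_cancel_left, dotProduct_single] at h1 h2
    set X : ℂ := star l * (Complex.I * h l j - Complex.I * h 0 j + star (Complex.I * h 0 j) * l ^ 2)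
      with hX
    have e1 : star l * (h l j * (((1 : ℝ) : ℂ) * Complex.I) - h 0 j * (((1 : ℝ) : ℂ) * Complex.I)
        + star (h 0 j * (((1 : ℝ) : ℂ) * Complex.I)) * l ^ 2) = X := by
      simp only [hX, star_mul', Complex.ofReal_one, star_one]
      ring
    have e2 : star l * (h l j * (((-1 : ℝ) : ℂ) * Complex.I)
        - h 0 j * (((-1 : ℝ) : ℂ) * Complex.I)
        + star (h 0 j * (((-1 : ℝ) : ℂ) * Complex.I)) * l ^ 2) = -X := by
      simp only [hX, star_mul', star_neg, Complex.ofReal_neg, Complex.ofReal_one, star_one]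
      ring
    rw [e1] at h1
    rw [e2, Complex.neg_re] at h2
    linarith
  choose b hb using hquad
  have hquadMap : ∀ l ∈ disc, h l = quadMap (h 0) b l := fun l hl ↦ funext fun j ↦ hb j l hl
  have hderφ : ∀ l ∈ disc, HasDerivAt φ (deriv φ l) l := fun l hl ↦
    (hφD.1.differentiableAt (hdo.mem_nhds hl)).hasDerivAt
  have hone : h 0 ⬝ᵥ deriv φ 0 = 1 := by
    rw [hpair 0 h0]
    have h1 := ((hf.1.1.differentiableAt (hDo.mem_nhds (hφD.2 h0))).hasFDerivAt).comp_hasDerivAt 0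
      (hderφ 0 h0)
    have h2 : f ∘ φ =ᶠ[𝓝 0] id := by
      filter_upwards [hdo.mem_nhds h0] with l hl
      exact hf.2 l hl
    exact (h1.congr_of_eventuallyEq h2.symm).unique (hasDerivAt_id 0)
  have hh0 : h 0 ≠ 0 := by
    intro h1
    rw [h1, zero_dotProduct] at hone
    exact zero_ne_one hone
  refine ⟨h 0, b, hquadMap, ⟨0, h0, hh0⟩, ?_, ?_⟩
  · have hspan := span_bddAbove_eq_top hΩo hΩne hΩc
      fun x hx v hv ↦ exists_add_smul_notMem_of_isTaut hT hx hv
    have hrad := ae_exists_isRadialLimit hφD hspan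
    have hqne := aeOnCircle_quadMap_ne_zero (a := h 0) (b := b) (l := 0)
      (by rw [← hquadMap 0 h0]; exact hh0)
    filter_upwards [hrad, hqne] with θ ⟨w, hw⟩ hq
    set ζ := Complex.exp (θ * Complex.I) with hζ
    have hζ1 : ‖ζ‖ = 1 := Complex.norm_exp_ofReal_mul_I θ
    have hζs : star ζ * ζ = 1 := by
      rw [mul_comm, Complex.star_def, Complex.mul_conj, Complex.normSq_eq_norm_sq, hζ1]
      simp
    refine ⟨w, hw, ?_⟩
    have hle : ∀ z ∈ D, (star ζ * (quadMap (h 0) b ζ ⬝ᵥ (z - w))).re ≤ 0 := by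
      intro z hz
      have hr : Tendsto (fun r : ℝ ↦ (r : ℂ) * ζ) (𝓝[<] 1) (𝓝 ζ) := by
        have h1 : Continuous fun r : ℝ ↦ (r : ℂ) * ζ := by fun_prop
        have h2 := h1.tendsto 1
        simp only [Complex.ofReal_one, one_mul] at h2
        exact h2.mono_left nhdsWithin_le_nhds
      have hqc : Continuous (quadMap (h 0) b) := by
        unfold quadMap
        fun_prop
      set c := h 0 ⬝ᵥ (z - φ 0) with hc
      have hlim : Tendsto (fun r : ℝ ↦ (star ((r : ℂ) * ζ) *
          (quadMap (h 0) b ((r : ℂ) * ζ) ⬝ᵥ (z - φ ((r : ℂ) * ζ)) - c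
            + star c * ((r : ℂ) * ζ) ^ 2)).re) (𝓝[<] 1)
          (𝓝 (star ζ * (quadMap (h 0) b ζ ⬝ᵥ (z - w) - c + star c * ζ ^ 2)).re) := by
        have h1 := tendsto_pi_nhds.1 ((hqc.tendsto ζ).comp hr)
        have h2 := tendsto_pi_nhds.1 (Tendsto.const_sub z hw)
        have h3 : Tendsto (fun r : ℝ ↦ quadMap (h 0) b ((r : ℂ) * ζ) ⬝ᵥ (z - φ ((r : ℂ) * ζ)))
            (𝓝[<] 1) (𝓝 (quadMap (h 0) b ζ ⬝ᵥ (z - w))) :=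
          tendsto_finsetSum _ fun j _ ↦ (h1 j).mul (h2 j)
        exact (Complex.continuous_re.tendsto _).comp
          (hr.star.mul ((h3.sub_const c).add ((hr.pow 2).const_mul (star c))))
      have hI : Ioo (0 : ℝ) 1 ∈ 𝓝[<] (1 : ℝ) := Ioo_mem_nhdsLT zero_lt_one
      have h1 := le_of_tendsto (b := (0 : ℝ)) hlim (by
        filter_upwards [hI] with r hr
        have hrd : (r : ℂ) * ζ ∈ disc := by
          simpa [disc, hζ1, abs_of_pos hr.1] using hr.2
        have := hgen (fun _ ↦ z) ⟨differentiableOn_const z, fun _ _ ↦ hz⟩ _ hrd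
        rwa [hquadMap _ hrd] at this)
      -- On the circle the terms in `c` combine to a number minus its conjugate, which has no real
      -- part.
      have h2 : star ζ * (quadMap (h 0) b ζ ⬝ᵥ (z - w) - c + star c * ζ ^ 2)
          = star ζ * (quadMap (h 0) b ζ ⬝ᵥ (z - w)) + (star (star ζ * c) - star ζ * c) := by
        rw [star_mul', star_star]
        linear_combination (star c * ζ) * hζs
      rw [h2, Complex.add_re, Complex.sub_re, Complex.star_def, Complex.conj_re, sub_self,
        add_zero] at h1
      exact h1
    intro z hz
    set q := quadMap (h 0) b ζ with hqdef
    -- A direction in which the functional strictly increases: equality at `z` would give a positive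
    -- value at the nearby point `z + ε u` of `D`.
    set u : Fin n → ℂ := fun j ↦ star (star ζ * q j) with hu
    have hpos : 0 < (star ζ * (q ⬝ᵥ u)).re := by
      have h1 : star ζ * (q ⬝ᵥ u) = ((∑ j, ‖q j‖ ^ 2 : ℝ) : ℂ) := by
        rw [dotProduct, Finset.mul_sum, Complex.ofReal_sum]
        refine Finset.sum_congr rfl fun j _ ↦ ?_
        rw [hu, ← mul_assoc, Complex.star_def, Complex.mul_conj, Complex.normSq_eq_norm_sq,
          norm_mul, RCLike.norm_conj, hζ1, one_mul]
      rw [h1, Complex.ofReal_re]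
      obtain ⟨j, hj⟩ := Function.ne_iff.1 hq
      exact Finset.sum_pos' (fun _ _ ↦ by positivity)
        ⟨j, Finset.mem_univ j, pow_pos (norm_pos_iff.2 hj) 2⟩
    obtain ⟨ε, hε, hεD⟩ : ∃ ε : ℝ, 0 < ε ∧ z + (ε : ℂ) • u ∈ D := by
      have h1 : Continuous fun ε : ℝ ↦ z + (ε : ℂ) • u := by fun_prop
      have h2 : ∀ᶠ ε : ℝ in 𝓝[>] 0, z + (ε : ℂ) • u ∈ D :=
        mem_nhdsWithin_of_mem_nhds (h1.continuousAt.preimage_mem_nhds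
          (hDo.mem_nhds (by simpa using hz)))
      obtain ⟨ε, h3, h4⟩ := (h2.and self_mem_nhdsWithin).exists
      exact ⟨ε, h4, h3⟩
    have h1 := hle _ hεD
    have h2 : star ζ * (q ⬝ᵥ (z + (ε : ℂ) • u - w))
        = star ζ * (q ⬝ᵥ (z - w)) + (ε : ℂ) * (star ζ * (q ⬝ᵥ u)) := by
      rw [add_sub_right_comm, dotProduct_add, dotProduct_smul, smul_eq_mul]
      ring
    rw [h2, Complex.add_re, Complex.re_ofReal_mul] at h1
    nlinarith [mul_pos hε hpos]
  · set G : ℂ → ℂ := fun l ↦ h l ⬝ᵥ (φ 0 - φ l) with hG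
    have hφj : ∀ j, DifferentiableOn ℂ (fun l ↦ φ l j) disc := differentiableOn_pi.1 hφD.1
    have hGd : DifferentiableOn ℂ G disc :=
      DifferentiableOn.fun_sum fun j _ ↦ (hhd j).mul ((hφj j).const_sub _)
    have hG0 : G 0 = 0 := by simp [hG]
    have hmd : DifferentiableOn ℂ (dslope G 0) disc :=
      (Complex.differentiableOn_dslope (hdo.mem_nhds h0)).2 hGd
    -- The value `-1` is `-(h 0 ⬝ᵥ φ'(0))`; it makes the real part of `G l / l` negative at `0`,
    -- which rules out a constant zero real part.
    have hGder : HasDerivAt G (-1) 0 := by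
      have h1 : HasDerivAt G (∑ j, (deriv (fun l ↦ h l j) 0 * (φ 0 j - φ 0 j)
          + h 0 j * -(deriv φ 0 j))) 0 := by
        refine HasDerivAt.fun_sum fun j _ ↦ ?_
        exact ((hhd j).differentiableAt (hdo.mem_nhds h0)).hasDerivAt.mul
          ((hasDerivAt_pi.1 (hderφ 0 h0) j).const_sub _)
      convert h1 using 1
      rw [← hone, dotProduct, ← Finset.sum_neg_distrib]
      exact Finset.sum_congr rfl fun j _ ↦ by ring
    have hm0 : dslope G 0 0 = -1 := by rw [dslope_same, hGder.deriv]
    have hml : ∀ l, l ≠ 0 → dslope G 0 l = h l ⬝ᵥ (l⁻¹ • (φ 0 - φ l)) := by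
      intro l hl
      rw [dslope_of_ne _ hl, slope_def_module, hG0, sub_zero, sub_zero, dotProduct_smul]
    have hmle : ∀ l ∈ disc, (dslope G 0 l).re ≤ 0 := by
      intro l hl
      rcases eq_or_ne l 0 with rfl | hl0
      · rw [hm0]; simp
      · have h1 := hgen (fun _ ↦ φ 0) ⟨differentiableOn_const _, fun _ _ ↦ hφD.2 h0⟩ l hl
        rw [sub_self, dotProduct_zero, sub_zero, star_zero, zero_mul, add_zero] at h1
        have h2 : star l * (h l ⬝ᵥ (φ 0 - φ l)) = ((‖l‖ ^ 2 : ℝ) : ℂ) * dslope G 0 l := by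
          rw [hml l hl0, dotProduct_smul, smul_eq_mul, ← Complex.normSq_eq_norm_sq,
            ← Complex.mul_conj, Complex.star_def]
          field_simp
        rw [h2, Complex.re_ofReal_mul] at h1
        have h3 : 0 < ‖l‖ ^ 2 := pow_pos (norm_pos_iff.2 hl0) 2
        exact nonpos_of_mul_nonpos_right h1 h3
    intro l hl hl0
    rw [← hml l hl0]
    exact re_neg_of_re_nonpos hmd hmle (by rw [hm0]; simp) hl
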